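/- Let $k$ be a field, $R=k[x_1,\dots,x_r]$ with its standard grading, and let $I\subset R$ be a homogeneous ideal containing no nonzero linear form such that $R/I$ is artinian Gorenstein, i.e. $R/I$ is artinian and its socle $\{a\in R/I : x_i a=0 \text{ for all } i\}$ is one-dimensional over $k$. Let $h_i=\dim_k [R/I]_i$ be its Hilbert function and let $e=\max\{i : h_i\neq 0\}$ be its socle degree. Assume that for a general linear form $L$ (that is, for every $L$ in some nonempty Zariski-open subset of the $k$-vector space $[R]_1\cong k^r$) the multiplication map $\times L:[R/I]_1\to[R/I]_2$ is injective. Assume moreover that $h_2=r$ and $e\ge 3$. Then $h_i=r$ for all $i=1,2,\dots,e-1$. Furthermore, if $R/I$ is presented by quadrics, i.e. $I$ is generated by homogeneous polynomials of degree $2$, then $e=3$. -/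

import Mathlib

attribute [local instance] MvPolynomial.gradedAlgebra

/-- `[R/I]_i`: the degree `i` graded piece of `R/I`, where `R = k[x_1, …, x_r]` has the standard
grading, i.e. the image of the forms of degree `i`. -/
noncomputable def gradedPiece {k : Type*} [Field k] {r : ℕ} (I : Ideal (MvPolynomial (Fin r) k)) (i : ℕ) :
    Submodule k (MvPolynomial (Fin r) k ⧸ I) :=
  (MvPolynomial.homogeneousSubmodule (Fin r) k i).map (Ideal.Quotient.mkₐ k I).toLinearMap

/-- The Hilbert function `h_i = dim_k [R/I]_i`. -/
noncomputable def hilbertFn {k : Type*} [Field k] {r : ℕ} (I : Ideal (MvPolynomial (Fin r) k))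
    (i : ℕ) : ℕ :=
  Module.finrank k (gradedPiece I i)

/-- The socle `(0 : 𝔪)` of `R/I`, where `𝔪 = (x_1, …, x_r)`. -/
noncomputable def quotientSocle {k : Type*} [Field k] {r : ℕ} (I : Ideal (MvPolynomial (Fin r) k)) :
    Submodule k (MvPolynomial (Fin r) k ⧸ I) where
  carrier := {a | ∀ i : Fin r, Ideal.Quotient.mk I (MvPolynomial.X i) * a = 0}
  zero_mem' := fun _ => mul_zero _
  add_mem' := fun ha hb i => by rw [mul_add, ha i, hb i, add_zero]
  smul_mem' := fun c a ha i => by rw [mul_smul_comm, ha i, smul_zero]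

/-- `R/I` is a standard graded artinian Gorenstein algebra: `I` is a homogeneous ideal, `R/I` is
artinian, and the socle of `R/I` is one-dimensional over `k`. -/
structure IsArtinianGorenstein {k : Type*} [Field k] {r : ℕ}
    (I : Ideal (MvPolynomial (Fin r) k)) : Prop where
  isHomogeneous : I.IsHomogeneous (MvPolynomial.homogeneousSubmodule (Fin r) k)
  isArtinianRing : IsArtinianRing (MvPolynomial (Fin r) k ⧸ I)
  finrank_socle : Module.finrank k (quotientSocle I) = 1

/-- `I` contains no nonzero linear form. -/
def ContainsNoLinearForm {k : Type*} [Field k] {r : ℕ}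
    (I : Ideal (MvPolynomial (Fin r) k)) : Prop :=
  ∀ F ∈ I, F.IsHomogeneous 1 → F = 0

/-- `e` is the socle degree of `R/I`: the last degree in which the Hilbert function is nonzero. -/
def IsSocleDegree {k : Type*} [Field k] {r : ℕ} (I : Ideal (MvPolynomial (Fin r) k))
    (e : ℕ) : Prop :=
  IsGreatest {i : ℕ | hilbertFn I i ≠ 0} e

/-- `I` is generated by quadrics. When `I` contains no nonzero linear form, this says that `R/I`
is presented by quadrics. -/
def GeneratedByQuadrics {k : Type*} [Field k] {r : ℕ}
    (I : Ideal (MvPolynomial (Fin r) k)) : Prop :=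
  ∃ S : Set (MvPolynomial (Fin r) k), (∀ F ∈ S, F.IsHomogeneous 2) ∧ I = Ideal.span S

/-- The linear form `a_1 x_1 + ⋯ + a_r x_r`. -/
noncomputable def linearForm {k : Type*} [Field k] {r : ℕ} (a : Fin r → k) :
    MvPolynomial (Fin r) k :=
  ∑ i, MvPolynomial.C (a i) * MvPolynomial.X i

/-- `U ⊆ k^r` is Zariski open: its complement is the set of common zeros of a set of
polynomials. -/
def IsZariskiOpen {k : Type*} [Field k] {r : ℕ} (U : Set (Fin r → k)) : Prop :=
  ∃ S : Set (MvPolynomial (Fin r) k), U = {a | ∀ f ∈ S, MvPolynomial.eval a f = 0}ᶜ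

/-- A general linear form of `k[x_1, …, x_r]` has the property `P`: every linear form in some
nonempty Zariski open subset of `[R]_1 ≅ k^r` has it. -/
def ForGeneralLinearForm {k : Type*} [Field k] {r : ℕ}
    (P : MvPolynomial (Fin r) k → Prop) : Prop :=
  ∃ U : Set (Fin r → k), IsZariskiOpen U ∧ U.Nonempty ∧ ∀ a ∈ U, P (linearForm a)

/-- Multiplication by the linear form `L` is injective on `R/I` from degree 1 to degree 2. -/
def MulInjectiveDegOne {k : Type*} [Field k] {r : ℕ} (I : Ideal (MvPolynomial (Fin r) k))
    (L : MvPolynomial (Fin r) k) : Prop :=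
  Set.InjOn (fun a : MvPolynomial (Fin r) k ⧸ I => Ideal.Quotient.mk I L * a)
    (gradedPiece I 1 : Set (MvPolynomial (Fin r) k ⧸ I))

/-!
Write `A = R/I` and let `l` be the class of one linear form `L` for which `×L : A₁ → A₂` is
injective.

Since `dim A₁ = r = dim A₂`, the map `×l : A₁ → A₂` is bijective. As `A` is generated in degree
one, surjectivity propagates upwards: `×l : Aᵢ → Aᵢ₊₁` is onto for every `i ≥ 1`
(`exists_mul_eq_of_surjOn`). The Gorenstein pairing `Aⱼ × A_{e-j} → A_e`
(`eq_zero_of_forall_mul_eq_zero`) turns this into injectivity of `×l` on `Aⱼ` for `j ≤ e - 2`: if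
`l a = 0`, then `a` annihilates `l A_{e-j-1} = A_{e-j}`. Hence `h₁ = ⋯ = h_{e-1} = r`.

Now let `I` be generated by quadrics, and suppose `e ≥ 4`, so that `×l` is injective on both `A₁`
and `A₂`. The operators `c ↦ l⁻¹ (xᵢ c)` on `A₁` commute, because `l²` times either composite is
`xᵢ xⱼ c`. They define a homomorphism `φ : R → End A₁` with `l ^ d · φ(F) c = F c` for every form
`F` of degree `d` (`exists_algHom_end_gradedPiece_one`). Quadrics in `I` therefore act as zero, so
`φ` kills `I`, whereas `φ(L) = 1`. But `l` is nilpotent, so `A₁ = 0`, which is absurd.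
-/

open MvPolynomial

/-! ### Graded pieces of the quotient -/

section GradedPieces

variable {k : Type*} [Field k] {r : ℕ} {I : Ideal (MvPolynomial (Fin r) k)}

theorem mk_mem_gradedPiece {F : MvPolynomial (Fin r) k} {i : ℕ} (hF : F.IsHomogeneous i) :
    Ideal.Quotient.mk I F ∈ gradedPiece I i :=
  Submodule.mem_map_of_mem (f := (Ideal.Quotient.mkₐ k I).toLinearMap) hF

theorem exists_isHomogeneous_of_mem_gradedPiece {i : ℕ} {a : MvPolynomial (Fin r) k ⧸ I}
    (ha : a ∈ gradedPiece I i) :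
    ∃ F : MvPolynomial (Fin r) k, F.IsHomogeneous i ∧ Ideal.Quotient.mk I F = a := by
  obtain ⟨F, hF, rfl⟩ := ha
  exact ⟨F, hF, rfl⟩

variable (I) in
theorem gradedPiece_eq_pow (i : ℕ) : gradedPiece I i = gradedPiece I 1 ^ i := by
  unfold gradedPiece
  rw [← homogeneousSubmodule_one_pow i (σ := Fin r) (R := k)]
  exact Submodule.map_pow _ _ _

variable (I) in
theorem gradedPiece_succ (i : ℕ) :
    gradedPiece I (i + 1) = gradedPiece I 1 * gradedPiece I i := by
  rw [gradedPiece_eq_pow I (i + 1), gradedPiece_eq_pow I i]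
  exact pow_succ' (gradedPiece I 1) i

theorem mul_mem_gradedPiece {i j : ℕ} {a b : MvPolynomial (Fin r) k ⧸ I}
    (ha : a ∈ gradedPiece I i) (hb : b ∈ gradedPiece I j) : a * b ∈ gradedPiece I (i + j) := by
  rw [gradedPiece_eq_pow] at *
  exact (pow_add (gradedPiece I 1) i j).symm ▸ Submodule.mul_mem_mul ha hb

theorem mul_mem_gradedPiece_succ {i : ℕ} {l a : MvPolynomial (Fin r) k ⧸ I}
    (hl : l ∈ gradedPiece I 1) (ha : a ∈ gradedPiece I i) : l * a ∈ gradedPiece I (i + 1) :=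
  add_comm 1 i ▸ mul_mem_gradedPiece hl ha

instance finite_gradedPiece (i : ℕ) : Module.Finite k (gradedPiece I i) :=
  Module.Finite.iff_fg.mpr ((homogeneousSubmodule_fg (Fin r) k i).map _)

theorem isHomogeneous_linearForm (a : Fin r → k) : (linearForm a).IsHomogeneous 1 :=
  IsHomogeneous.sum _ _ _ fun i _ => (isHomogeneous_C_mul_X (a i) i)

theorem finrank_gradedPiece_one (hlin : ContainsNoLinearForm I) :
    Module.finrank k (gradedPiece I 1) = r := by
  let f : (Fin r → k) →ₗ[k] MvPolynomial (Fin r) k ⧸ I :=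
    Fintype.linearCombination k fun i => Ideal.Quotient.mk I (X i)
  have hf (a : Fin r → k) : f a = Ideal.Quotient.mk I (linearForm a) := by
    simp only [f, Fintype.linearCombination_apply, linearForm, map_sum, ← smul_eq_C_mul]
    rfl
  have hinj : Function.Injective f := by
    refine (injective_iff_map_eq_zero f).mpr fun a ha => ?_
    rw [hf, Ideal.Quotient.eq_zero_iff_mem] at ha
    have h0 := hlin _ ha (isHomogeneous_linearForm a)
    funext i
    have := congrArg (eval (Pi.single i 1)) h0
    simpa [linearForm, Pi.single_apply] using this
  have hrange : LinearMap.range f = gradedPiece I 1 := by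
    rw [Fintype.range_linearCombination, gradedPiece, homogeneousSubmodule_one_eq_span_X,
      Submodule.map_span, ← Set.range_comp]
    rfl
  rw [← hrange, LinearMap.finrank_range_of_inj hinj, Module.finrank_fin_fun]

/-- Two distinct graded pieces of the quotient by a homogeneous ideal meet only in zero. -/
theorem eq_zero_of_mem_gradedPiece_of_ne
    (hI : I.IsHomogeneous (homogeneousSubmodule (Fin r) k)) {i j : ℕ} (hij : i ≠ j)
    {a : MvPolynomial (Fin r) k ⧸ I} (hi : a ∈ gradedPiece I i) (hj : a ∈ gradedPiece I j) :
    a = 0 := by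
  obtain ⟨F, hF, rfl⟩ := exists_isHomogeneous_of_mem_gradedPiece hi
  obtain ⟨G, hG, hFG⟩ := exists_isHomogeneous_of_mem_gradedPiece hj
  rw [eq_comm, Ideal.Quotient.mk_eq_mk_iff_sub_mem] at hFG
  have h := homogeneousComponent_mem_of_mem hI hFG i
  rw [map_sub, homogeneousComponent_of_mem hF, homogeneousComponent_of_mem hG, if_pos rfl,
    if_neg hij, sub_zero] at h
  exact Ideal.Quotient.eq_zero_iff_mem.mpr h

end GradedPieces

/-! ### Multiplication by a linear form -/

section LinearFormMultiplication

variable {k : Type*} [Field k] {r : ℕ} {I : Ideal (MvPolynomial (Fin r) k)}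

/-- Surjectivity of multiplication by an element propagates to higher degrees, since the quotient
is generated in degree one. -/
theorem exists_mul_eq_of_surjOn {l : MvPolynomial (Fin r) k ⧸ I}
    {i : ℕ} (hsurj : ∀ x ∈ gradedPiece I (i + 1), ∃ y ∈ gradedPiece I i, l * y = x)
    {j : ℕ} (hij : i ≤ j) : ∀ x ∈ gradedPiece I (j + 1), ∃ y ∈ gradedPiece I j, l * y = x := by
  induction j, hij using Nat.le_induction with
  | base => exact hsurj
  | succ j _ ih =>
    intro x hx
    rw [gradedPiece_succ] at hx
    induction hx using Submodule.mul_induction_on' with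
    | mem_mul_mem m hm n hn =>
      obtain ⟨y, hy, rfl⟩ := ih n hn
      exact ⟨m * y, mul_mem_gradedPiece_succ hm hy, by ring⟩
    | add x _ y _ hx hy =>
      obtain ⟨x', hx', rfl⟩ := hx
      obtain ⟨y', hy', rfl⟩ := hy
      exact ⟨x' + y', add_mem hx' hy', mul_add _ _ _⟩

/-- Multiplication by a linear form, as a linear map between consecutive graded pieces. -/
noncomputable def mulGradedPiece {l : MvPolynomial (Fin r) k ⧸ I} (hl : l ∈ gradedPiece I 1)
    (i : ℕ) : gradedPiece I i →ₗ[k] gradedPiece I (i + 1) :=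
  (LinearMap.mulLeft k l).restrict fun _ ha => mul_mem_gradedPiece_succ hl ha

@[simp]
theorem coe_mulGradedPiece {l : MvPolynomial (Fin r) k ⧸ I} (hl : l ∈ gradedPiece I 1) (i : ℕ)
    (a : gradedPiece I i) : (mulGradedPiece hl i a : MvPolynomial (Fin r) k ⧸ I) = l * a :=
  rfl

theorem mulGradedPiece_injective {l : MvPolynomial (Fin r) k ⧸ I} (hl : l ∈ gradedPiece I 1)
    {i : ℕ} (hinj : ∀ a ∈ gradedPiece I i, l * a = 0 → a = 0) :
    Function.Injective (mulGradedPiece hl i) :=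
  (injective_iff_map_eq_zero _).mpr fun a ha =>
    Subtype.ext (hinj a a.2 (congrArg Subtype.val ha))

end LinearFormMultiplication

/-! ### The Gorenstein pairing -/

section Gorenstein

variable {k : Type*} [Field k] {r : ℕ} {I : Ideal (MvPolynomial (Fin r) k)}

theorem gradedPiece_succ_socleDegree {e : ℕ} (he : IsSocleDegree I e) :
    gradedPiece I (e + 1) = ⊥ := by
  refine Submodule.finrank_eq_zero.mp (by_contra fun h => ?_)
  exact absurd (he.2 h) (by simp)

theorem quotientSocle_eq_gradedPiece (hG : IsArtinianGorenstein I) {e : ℕ}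
    (he : IsSocleDegree I e) : quotientSocle I = gradedPiece I e := by
  have hle : gradedPiece I e ≤ quotientSocle I := fun a ha i => by
    have h := mul_mem_gradedPiece_succ (mk_mem_gradedPiece (I := I) (isHomogeneous_X k i)) ha
    rwa [gradedPiece_succ_socleDegree he, Submodule.mem_bot] at h
  have : Module.Finite k (quotientSocle I) :=
    Module.finite_of_finrank_pos (by rw [hG.finrank_socle]; exact one_pos)
  refine (Submodule.eq_of_le_of_finrank_le hle ?_).symm
  rw [hG.finrank_socle]
  exact Nat.one_le_iff_ne_zero.mpr he.1

/-- Nondegeneracy of the multiplication pairing `[R/I]_i × [R/I]_j → [R/I]_e`, for `i + j = e`. -/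
theorem eq_zero_of_forall_mul_eq_zero (hG : IsArtinianGorenstein I) {e : ℕ}
    (he : IsSocleDegree I e) {i j : ℕ} (hij : i + j = e) {a : MvPolynomial (Fin r) k ⧸ I}
    (ha : a ∈ gradedPiece I i) (h : ∀ b ∈ gradedPiece I j, a * b = 0) : a = 0 := by
  induction j generalizing i a with
  | zero => simpa using h 1 (mk_mem_gradedPiece (isHomogeneous_one (Fin r) k))
  | succ j ih =>
    -- By induction every `xₛ a` vanishes, so `a` lies in the socle, which lives in degree `e ≠ i`.
    have hsoc : a ∈ quotientSocle I := fun s => by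
      have hs := mk_mem_gradedPiece (I := I) (isHomogeneous_X k s)
      refine ih (by omega) (mul_mem_gradedPiece_succ hs ha) fun b hb => ?_
      rw [mul_comm _ a, mul_assoc]
      exact h _ (mul_mem_gradedPiece_succ hs hb)
    rw [quotientSocle_eq_gradedPiece hG he] at hsoc
    exact eq_zero_of_mem_gradedPiece_of_ne hG.isHomogeneous (by omega) ha hsoc

/-- The Gorenstein pairing turns surjectivity of multiplication by a linear form in degrees at
least one into injectivity in degrees at most `e - 2`. -/
theorem eq_zero_of_mul_eq_zero_of_surjOn (hG : IsArtinianGorenstein I) {e : ℕ}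
    (he : IsSocleDegree I e) {l : MvPolynomial (Fin r) k ⧸ I}
    (hsurj : ∀ i, 1 ≤ i → ∀ x ∈ gradedPiece I (i + 1), ∃ y ∈ gradedPiece I i, l * y = x)
    {j : ℕ} (hj : j + 2 ≤ e) {a : MvPolynomial (Fin r) k ⧸ I} (ha : a ∈ gradedPiece I j)
    (hla : l * a = 0) : a = 0 := by
  refine eq_zero_of_forall_mul_eq_zero hG he (j := (e - j - 1) + 1) (by omega) ha fun b hb => ?_
  obtain ⟨c, -, rfl⟩ := hsurj _ (by omega) b hb
  rw [← mul_assoc, mul_comm a, hla, zero_mul]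

end Gorenstein

/-! ### The action of the polynomial ring on the degree one piece -/

section Action

open scoped IsMulCommutative in
/-- Pairwise commuting elements of an algebra, commutative or not, can be substituted for the
variables of a polynomial ring. -/
theorem exists_algHom_X_eq_of_commute {k σ B : Type*} [Field k] [Ring B] [Algebra k B]
    (M : σ → B) (hM : ∀ i j, M i * M j = M j * M i) :
    ∃ φ : MvPolynomial σ k →ₐ[k] B, ∀ i, φ (X i) = M i := by
  have : IsMulCommutative (Algebra.adjoin k (Set.range M)) :=
    Algebra.isMulCommutative_adjoin k (by
      rintro _ ⟨i, rfl⟩ _ ⟨j, rfl⟩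
      exact hM i j)
  refine ⟨(Algebra.adjoin k (Set.range M)).val.comp
    (aeval (R := k) fun i : σ =>
      (⟨M i, Algebra.subset_adjoin ⟨i, rfl⟩⟩ : Algebra.adjoin k (Set.range M))), fun i => ?_⟩
  simp

variable {k : Type*} [Field k] {r : ℕ} {I : Ideal (MvPolynomial (Fin r) k)}

/-- If multiplication by `l` is bijective from degree 1 to degree 2 and injective from degree 2 to
degree 3, then a form `F` of degree `d` acts on `[R/I]_1` as `l⁻ᵈ F`. -/
theorem exists_algHom_end_gradedPiece_one {l : MvPolynomial (Fin r) k ⧸ I}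
    (hl : l ∈ gradedPiece I 1)
    (hbij : Function.Bijective (mulGradedPiece hl 1))
    (hinj : ∀ a ∈ gradedPiece I 2, l * a = 0 → a = 0) :
    ∃ φ : MvPolynomial (Fin r) k →ₐ[k] Module.End k (gradedPiece I 1),
      ∀ (d : ℕ) (F : MvPolynomial (Fin r) k), F.IsHomogeneous d → ∀ c : gradedPiece I 1,
        l ^ d * (φ F c : MvPolynomial (Fin r) k ⧸ I) = Ideal.Quotient.mk I F * c := by
  let ψ := LinearEquiv.ofBijective _ hbij
  have hψ (b : gradedPiece I 2) : l * (ψ.symm b : MvPolynomial (Fin r) k ⧸ I) = b :=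
    congrArg Subtype.val (ψ.apply_symm_apply b)
  have hX (i : Fin r) := mk_mem_gradedPiece (I := I) (isHomogeneous_X k i)
  let M (i : Fin r) : Module.End k (gradedPiece I 1) :=
    ψ.symm.toLinearMap ∘ₗ mulGradedPiece (hX i) 1
  have hlM (i : Fin r) (c : gradedPiece I 1) :
      l * (M i c : MvPolynomial (Fin r) k ⧸ I) = Ideal.Quotient.mk I (X i) * c := hψ _
  have hcancel (a b : gradedPiece I 1)
      (h : l * (l * (a : MvPolynomial (Fin r) k ⧸ I)) = l * (l * b)) : a = b := by
    refine hbij.1 (Subtype.ext (sub_eq_zero.mp (hinj _ (sub_mem (SetLike.coe_mem _)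
      (SetLike.coe_mem _)) ?_)))
    rw [mul_sub, coe_mulGradedPiece, coe_mulGradedPiece, h, sub_self]
  have hcomm (i j : Fin r) : M i * M j = M j * M i := by
    refine LinearMap.ext fun c => hcancel _ _ ?_
    rw [Module.End.mul_apply, Module.End.mul_apply, hlM, hlM, mul_left_comm, hlM,
      mul_left_comm l, hlM, mul_left_comm]
  obtain ⟨φ, hφ⟩ := exists_algHom_X_eq_of_commute (k := k) M hcomm
  have hone (F : MvPolynomial (Fin r) k) (hF : F ∈ homogeneousSubmodule (Fin r) k 1)
      (c : gradedPiece I 1) :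
      l * (φ F c : MvPolynomial (Fin r) k ⧸ I) = Ideal.Quotient.mk I F * c := by
    rw [homogeneousSubmodule_one_eq_span_X] at hF
    induction hF using Submodule.span_induction with
    | mem F hF =>
      obtain ⟨i, rfl⟩ := hF
      rw [hφ, hlM]
    | zero => simp
    | add F G _ _ hF hG => simp [mul_add, add_mul, hF, hG]
    | smul t F _ hF =>
      have h : Ideal.Quotient.mk I (t • F) = t • Ideal.Quotient.mk I F := rfl
      rw [map_smul, h, LinearMap.smul_apply, Submodule.coe_smul, smul_mul_assoc, ← hF]
      exact mul_smul_comm _ _ _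
  refine ⟨φ, fun d => ?_⟩
  induction d with
  | zero =>
    intro F hF c
    obtain ⟨t, rfl⟩ : ∃ t : k, F = C t :=
      ⟨_, totalDegree_eq_zero_iff_eq_C.mp ((totalDegree_zero_iff_isHomogeneous _).mpr hF)⟩
    have h1 : φ (C t) = algebraMap k _ t := φ.commutes t
    have h2 : Ideal.Quotient.mk I (C t) = algebraMap k _ t := rfl
    rw [h1, h2, pow_zero, one_mul, Module.algebraMap_end_apply, ← Algebra.smul_def]
    rfl
  | succ d ih =>
    intro F hF
    rw [← mem_homogeneousSubmodule, ← homogeneousSubmodule_one_pow, pow_succ',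
      homogeneousSubmodule_one_pow] at hF
    induction hF using Submodule.mul_induction_on' with
    | mem_mul_mem F hF G hG =>
      intro c
      rw [map_mul, Module.End.mul_apply, pow_succ, mul_assoc, hone F hF, mul_left_comm,
        ih G hG, map_mul, mul_assoc]
    | add F _ G _ hF hG =>
      intro c
      simp [mul_add, add_mul, hF, hG]

/-- An ideal generated by quadrics whose quotient satisfies the hypotheses of
`exists_algHom_end_gradedPiece_one` for a nilpotent `l` contains all linear forms. -/
theorem gradedPiece_one_eq_bot_of_generatedByQuadrics (hquad : GeneratedByQuadrics I)
    {l : MvPolynomial (Fin r) k ⧸ I} (hl : l ∈ gradedPiece I 1)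
    (hbij : Function.Bijective (mulGradedPiece hl 1))
    (hinj : ∀ a ∈ gradedPiece I 2, l * a = 0 → a = 0) (hnil : IsNilpotent l) :
    gradedPiece I 1 = ⊥ := by
  obtain ⟨φ, hφ⟩ := exists_algHom_end_gradedPiece_one hl hbij hinj
  have hinj₁ (a : gradedPiece I 1) (h : l * (a : MvPolynomial (Fin r) k ⧸ I) = 0) : a = 0 :=
    hbij.1 (Subtype.ext (by simpa using h))
  have hker : I ≤ RingHom.ker φ := by
    obtain ⟨S, hS, hI⟩ := hquad
    conv_lhs => rw [hI]
    refine Ideal.span_le.mpr fun F hF => LinearMap.ext fun c => ?_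
    have hFI : F ∈ I := hI ▸ Ideal.subset_span hF
    have h := hφ 2 F (hS F hF) c
    rw [Ideal.Quotient.eq_zero_iff_mem.mpr hFI, zero_mul, pow_two, mul_assoc] at h
    exact hinj₁ _ (hinj _ (mul_mem_gradedPiece_succ hl (SetLike.coe_mem _)) h)
  obtain ⟨L, hL, rfl⟩ := exists_isHomogeneous_of_mem_gradedPiece hl
  have hφL : φ L = 1 := LinearMap.ext fun c => hbij.1 (Subtype.ext (by
    simpa using hφ 1 L hL c))
  obtain ⟨N, hN⟩ := hnil
  rw [← map_pow, Ideal.Quotient.eq_zero_iff_mem] at hN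
  have h10 : (1 : Module.End k (gradedPiece I 1)) = 0 := by
    simpa [hφL] using hker hN
  refine (Submodule.eq_bot_iff _).mpr fun a ha => ?_
  exact congrArg Subtype.val (LinearMap.congr_fun h10 ⟨a, ha⟩)

end Action

/-! ### The Hilbert function -/

theorem mainTheorem5 {k : Type*} [Field k] {r : ℕ} (I : Ideal (MvPolynomial (Fin r) k))
    (hG : IsArtinianGorenstein I) (hlin : ContainsNoLinearForm I)
    (e : ℕ) (he : IsSocleDegree I e) (he3 : 3 ≤ e)
    (hinj : ForGeneralLinearForm (fun L : MvPolynomial (Fin r) k => MulInjectiveDegOne I L))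
    (h2 : hilbertFn I 2 = r) :
    (∀ i : ℕ, 1 ≤ i → i ≤ e - 1 → hilbertFn I i = r) ∧ (GeneratedByQuadrics I → e = 3) := by
  obtain ⟨U, -, ⟨a, haU⟩, hU⟩ := hinj
  have hl := mk_mem_gradedPiece (I := I) (isHomogeneous_linearForm a)
  have hLinj : MulInjectiveDegOne I (linearForm a) := hU a haU
  unfold MulInjectiveDegOne at hLinj
  generalize Ideal.Quotient.mk I (linearForm a) = l at hl hLinj
  have h1 : hilbertFn I 1 = r := finrank_gradedPiece_one hlin
  have hbij : Function.Bijective (mulGradedPiece hl 1) := by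
    have hi : Function.Injective (mulGradedPiece hl 1) := mulGradedPiece_injective hl
      fun b hb h => hLinj hb (zero_mem _) (by simpa using h)
    exact ⟨hi, (LinearMap.injective_iff_surjective_of_finrank_eq_finrank
      (h1.trans h2.symm)).mp hi⟩
  have hsurj (i : ℕ) (hi : 1 ≤ i) :
      ∀ x ∈ gradedPiece I (i + 1), ∃ y ∈ gradedPiece I i, l * y = x :=
    exists_mul_eq_of_surjOn (fun x hx => by
      obtain ⟨y, hy⟩ := hbij.2 ⟨x, hx⟩
      exact ⟨y, y.2, congrArg Subtype.val hy⟩) hi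
  have hker {j : ℕ} (hj : j + 2 ≤ e) (b : MvPolynomial (Fin r) k ⧸ I) (hb : b ∈ gradedPiece I j)
      (h : l * b = 0) : b = 0 := eq_zero_of_mul_eq_zero_of_surjOn hG he hsurj hj hb h
  refine ⟨fun i hi => ?_, fun hquad => ?_⟩
  · induction i, hi using Nat.le_induction with
    | base => exact fun _ => h1
    | succ i hi ih =>
      intro hie
      refine Eq.trans ?_ (ih (by omega))
      refine (LinearEquiv.finrank_eq (LinearEquiv.ofBijective (mulGradedPiece hl i)
        ⟨mulGradedPiece_injective hl (hker (by omega)), fun x => ?_⟩)).symm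
      obtain ⟨y, hy, hyx⟩ := hsurj i hi x x.2
      exact ⟨⟨y, hy⟩, Subtype.ext hyx⟩
  · by_contra hne
    have hnil : IsNilpotent l := by
      refine ⟨e + 1, ?_⟩
      have h := Submodule.pow_mem_pow (gradedPiece I 1) hl (e + 1)
      rwa [← gradedPiece_eq_pow, gradedPiece_succ_socleDegree he, Submodule.mem_bot] at h
    have hbot := gradedPiece_one_eq_bot_of_generatedByQuadrics hquad hl hbij
      (hker (by omega)) hnil
    -- Then `[R/I]_e = [R/I]_1 ^ e` vanishes as well, contrary to the choice of `e`.
    refine he.1 (Submodule.finrank_eq_zero.mpr ?_)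
    rw [gradedPiece_eq_pow, hbot, Submodule.bot_pow (by omega)]
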